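/- Let $G$ be a finite simple graph with adjacency matrix $A(G)$, and let $\mu$ be an eigenvalue of $A(G)$ of multiplicity $k$. A set $X\subseteq V(G)$ is a star set for $\mu$ in $G$ if $|X|=k$ and $\mu$ is not an eigenvalue of the induced subgraph $G-X$; in this case $G-X$ is called a star complement for $\mu$ in $G$. Let $G_1, G_2, G_3$ be the following graphs. Take $K_{3,3}$ with parts $\{v_1,v_2,v_3\}$ and $\{w_1,w_2,w_3\}$. For a set $S\subseteq\{1,2,3\}^2$ add, for each $(i,j)\in S$, a new vertex $u_{ij}$ whose neighbours in $K_{3,3}$ are exactly $v_i$ and $w_j$, and let distinct new vertices $u_{ij}$, $u_{i'j'}$ be adjacent if and only if $i\neq i'$ and $j\neq j'$. Then $G_1$ (4-regular of order 9), $G_2$ (5-regular of order 12) and $G_3$ (6-regular of order 15, strongly regular with parameters $(15,6,1,3)$) are the graphs obtained for $S=\{(i,j): i=j\}$, $S=\{(i,j): i\ne j\}$ and $S=\{1,2,3\}^2$, respectively. **Theorem.** Let $s\ge 1$, and let $G$ be an $r$-regular graph of order $n$ with $K_{s,s}$ as a star complement for the eigenvalue $\mu\notin\{-1,0\}$ of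 multiplicity $k$. Then $k\le s(r-s)$, equivalently $n\le s(r-s+2)$. If $s\geq 2$, then equality holds (in either, hence in both, of these inequalities) if and only if $\mu=1$ and $G$ is isomorphic to $G_1$, $G_2$ or $G_3$. -/

import Mathlib

namespace StarComplement

open Classical in
/-- The adjacency operator of `G` on `ℝ^V`. -/
noncomputable def adjEnd {V : Type*} [Fintype V] (G : SimpleGraph V) :
    Module.End ℝ (V → ℝ) :=
  Matrix.toLin' (G.adjMatrix ℝ)

/-- `μ` is an (adjacency) eigenvalue of `G`. -/
def IsEigenvalue {V : Type*} [Fintype V] (G : SimpleGraph V) (μ : ℝ) : Prop :=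
  (adjEnd G).HasEigenvalue μ

/-- The multiplicity of `μ` as an eigenvalue of `G`: the dimension of its eigenspace.
As the adjacency matrix is real symmetric, it is also the algebraic multiplicity. -/
noncomputable def multiplicity {V : Type*} [Fintype V] (G : SimpleGraph V) (μ : ℝ) : ℕ :=
  Module.finrank ℝ ((adjEnd G).eigenspace μ)

open Classical in
/-- `X` is a star set for the eigenvalue `μ` of `G`: the size of `X` is the multiplicity of `μ`,
and `μ` is not an eigenvalue of the induced subgraph `G - X`. -/
def IsStarSet {V : Type*} [Fintype V] (G : SimpleGraph V) (μ : ℝ) (X : Set V) : Prop :=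
  X.ncard = multiplicity G μ ∧ ¬ IsEigenvalue (G.induce Xᶜ) μ

/-- The graph `H` is (isomorphic to) a star complement for the eigenvalue `μ` of `G`. -/
def HasStarComplement {V W : Type*} [Fintype V] (G : SimpleGraph V) (μ : ℝ)
    (H : SimpleGraph W) : Prop :=
  ∃ X : Set V, IsStarSet G μ X ∧ Nonempty (G.induce Xᶜ ≃g H)

/-- For a set `S` of cells of the `3 × 3` grid: the graph obtained from `K_{3,3}`, with parts
`v_0, v_1, v_2` and `w_0, w_1, w_2`, by adding for each cell `(i, j)` of `S` a vertex whose
neighbours in `K_{3,3}` are `v_i` and `w_j`, two added vertices being adjacent exactly when they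
have no common neighbour in `K_{3,3}`, that is, when their cells lie in different rows and
different columns. -/
def gridGraph (S : Set (Fin 3 × Fin 3)) : SimpleGraph ((Fin 3 ⊕ Fin 3) ⊕ S) where
  Adj
    | .inl (.inl _), .inl (.inl _) => False
    | .inl (.inl _), .inl (.inr _) => True
    | .inl (.inr _), .inl (.inl _) => True
    | .inl (.inr _), .inl (.inr _) => False
    | .inl (.inl i), .inr c => c.1.1 = i
    | .inl (.inr j), .inr c => c.1.2 = j
    | .inr c, .inl (.inl i) => c.1.1 = i
    | .inr c, .inl (.inr j) => c.1.2 = j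
    | .inr c, .inr d => c.1.1 ≠ d.1.1 ∧ c.1.2 ≠ d.1.2
  symm := ⟨by
    rintro ((i | i) | c) ((j | j) | d) h <;> first | exact h | exact ⟨h.1.symm, h.2.symm⟩⟩
  loopless := ⟨by
    rintro ((i | i) | c) h
    · exact h
    · exact h
    · exact h.1 rfl⟩

/-- The 4-regular graph on 9 vertices with spectrum `-3, (-2)^2, 0^2, 1^3, 4`
(the added vertices are the diagonal cells). -/
def G₁ : SimpleGraph ((Fin 3 ⊕ Fin 3) ⊕ {c : Fin 3 × Fin 3 | c.1 = c.2}) :=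
  gridGraph {c : Fin 3 × Fin 3 | c.1 = c.2}

/-- The 5-regular graph on 12 vertices with spectrum `(-3)^3, (-1)^2, 1^6, 5`
(the added vertices are the off-diagonal cells). -/
def G₂ : SimpleGraph ((Fin 3 ⊕ Fin 3) ⊕ {c : Fin 3 × Fin 3 | c.1 ≠ c.2}) :=
  gridGraph {c : Fin 3 × Fin 3 | c.1 ≠ c.2}

/-- The 6-regular graph on 15 vertices with spectrum `(-3)^5, 1^9, 6`, strongly regular with
parameters `(15, 6, 1, 3)` (the added vertices are all the cells). -/
def G₃ : SimpleGraph ((Fin 3 ⊕ Fin 3) ⊕ (Set.univ : Set (Fin 3 × Fin 3))) :=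
  gridGraph Set.univ

end StarComplement

/-! Restriction to a star set `X` is injective on the eigenspace, hence bijective by dimension. So
each `u` in `X` has an eigenvector `x` equal to 1 at `u` and 0 elsewhere on `X`. Let `P`, `Q` be its
sums over the parts of `K_{s,s}`, and `a`, `b` the numbers of neighbours of `u` there. The
eigenvector equations give `μP - sQ = a` and `μQ - sP = b`. If `μ ≠ r`, orthogonality to the all-one
vector gives `P + Q = -1`, so `a + b = s - μ` for every `u`. Counting edges between `X` and
`K_{s,s}` yields `k(s - μ) = 2s(r - s)` (`card_mul`). The equation at `u` itself excludes `s - μ =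
0` and `s - μ = 1` by integrality (`two_le_add`), which is the bound. Equality means `s - μ = 2`;
the same equation then forces `s = 3`, `μ = 1`, `a = b = 1` (`eq_three_of_add_eq_two`). Each `u` is
now a cell of a `3 × 3` grid, the equations at the other vertices of `X` fix all adjacencies, and
regularity makes the set of cells one of three patterns. If `μ = r`, eigenvectors are constant along
edges, so `k = 1`. -/

namespace StarComplement

/-! ### Eigenvectors and star sets -/

/-- The entries of the adjacency matrix. -/
noncomputable def adjVal {V : Type*} (G : SimpleGraph V) (v w : V) : ℝ :=
  open Classical in if G.Adj v w then 1 else 0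

lemma mem_eigenspace_adjEnd_iff {V : Type*} [Fintype V] (G : SimpleGraph V) (μ : ℝ) (x : V → ℝ) :
    x ∈ (adjEnd G).eigenspace μ ↔ ∀ v, ∑ w, adjVal G v w * x w = μ * x v := by
  rw [Module.End.mem_eigenspace_iff, funext_iff]
  simp [adjEnd, adjVal, Matrix.toLin'_apply, Matrix.mulVec, dotProduct,
    SimpleGraph.adjMatrix_apply]

/-- An eigenvector vanishing on a star set is zero. -/
lemma eq_zero_of_mem_eigenspace {V : Type*} [Fintype V] {G : SimpleGraph V} {μ : ℝ} {X : Set V}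
    [Fintype (Xᶜ : Set V)] (hX : ¬ IsEigenvalue (G.induce Xᶜ) μ) {x : V → ℝ}
    (hx : x ∈ (adjEnd G).eigenspace μ) (h0 : ∀ v ∈ X, x v = 0) : x = 0 := by
  rw [mem_eigenspace_adjEnd_iff] at hx
  have hy : (fun v : (Xᶜ : Set V) => x v) ∈ (adjEnd (G.induce Xᶜ)).eigenspace μ := by
    rw [mem_eigenspace_adjEnd_iff]
    intro v
    rw [← hx v]
    refine Fintype.sum_of_injective Subtype.val Subtype.val_injective _ _ (fun w hw => ?_)
      fun w => rfl
    rw [h0 w (by simpa using hw), mul_zero]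
  have hz : (fun v : (Xᶜ : Set V) => x v) = 0 := by
    by_contra hne
    exact hX (Module.End.hasEigenvalue_of_hasEigenvector ⟨hy, hne⟩)
  funext v
  by_cases hv : v ∈ X
  · exact h0 v hv
  · exact congrFun hz ⟨v, hv⟩

/-- A function on a star set extends to an eigenvector. -/
lemma IsStarSet.exists_eigenvector {V : Type*} [Fintype V] {G : SimpleGraph V} {μ : ℝ} {X : Set V}
    (hX : IsStarSet G μ X) (f : X → ℝ) :
    ∃ x ∈ (adjEnd G).eigenspace μ, ∀ u : X, x u = f u := by
  classical
  let R : (adjEnd G).eigenspace μ →ₗ[ℝ] (X → ℝ) :=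
    (LinearMap.funLeft ℝ ℝ ((↑) : X → V)).comp (Submodule.subtype _)
  have hinj : Function.Injective R := by
    rw [← LinearMap.ker_eq_bot, LinearMap.ker_eq_bot']
    intro x hx
    exact Subtype.ext (eq_zero_of_mem_eigenspace hX.2 x.2 fun v hv => congrFun hx ⟨v, hv⟩)
  -- The condition `|X| = multiplicity` makes the injective restriction onto.
  have hdim : Module.finrank ℝ ((adjEnd G).eigenspace μ) = Module.finrank ℝ (X → ℝ) := by
    rw [Module.finrank_fintype_fun_eq_card, ← Nat.card_eq_fintype_card, Nat.card_coe_set_eq]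
    exact hX.1.symm
  obtain ⟨x, hx⟩ := (LinearMap.injective_iff_surjective_of_finrank_eq_finrank hdim).1 hinj f
  exact ⟨x, x.2, fun u => congrFun hx u⟩

open Classical in
/-- The vertex set of a graph with star complement `K_{s,s}`, decomposed. -/
noncomputable def vertexEquiv {V : Type*} {s : ℕ} (X : Set V)
    (e : (Xᶜ : Set V) ≃ Fin s ⊕ Fin s) : (Fin s ⊕ Fin s) ⊕ X ≃ V :=
  (Equiv.sumCongr e.symm (Equiv.refl _)).trans
    ((Equiv.sumComm _ _).trans (Equiv.Set.sumCompl X))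

/-- `G` is a regular graph on `(Fin s ⊕ Fin s) ⊕ U` with star complement `K_{s,s}` for `μ`
and star set `U`, spelled out in terms of eigenvectors. -/
structure Config (s r : ℕ) (μ : ℝ) {U : Type*} [Fintype U]
    (G : SimpleGraph ((Fin s ⊕ Fin s) ⊕ U)) : Prop where
  adj_iff : ∀ x y, G.Adj (.inl x) (.inl y) ↔ (completeBipartiteGraph (Fin s) (Fin s)).Adj x y
  degree : ∀ v, ∑ w, adjVal G v w = r
  exists_vec : ∀ u : U, ∃ x : (Fin s ⊕ Fin s) ⊕ U → ℝ,
    (∀ v, ∑ w, adjVal G v w * x w = μ * x v) ∧ x (.inr u) = 1 ∧ ∀ v, v ≠ u → x (.inr v) = 0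

lemma sum_adjVal {V : Type*} [Fintype V] (G : SimpleGraph V) [DecidableRel G.Adj] (v : V) :
    ∑ w, adjVal G v w = G.degree v := by
  classical
  have hv (w : V) : adjVal G v w = if w ∈ G.neighborFinset v then 1 else 0 := by simp [adjVal]
  simp only [hv, Finset.sum_boole, ← SimpleGraph.card_neighborFinset_eq_degree]
  congr 2
  ext w
  simp

lemma IsStarSet.config {V : Type*} [Fintype V] {G : SimpleGraph V} [DecidableRel G.Adj] {μ : ℝ}
    {X : Set V} {s r : ℕ} [Fintype X] (hX : IsStarSet G μ X) (hreg : G.IsRegularOfDegree r)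
    (e : G.induce Xᶜ ≃g completeBipartiteGraph (Fin s) (Fin s)) :
    Config s r μ (G.comap (vertexEquiv X e.toEquiv)) := by
  classical
  refine ⟨fun x y => ?_, fun v => ?_, fun u => ?_⟩
  · rw [← e.symm.map_adj_iff]
    simp only [vertexEquiv, SimpleGraph.comap_adj]
    rfl
  · have := sum_adjVal G (vertexEquiv X e.toEquiv v)
    rw [hreg, ← Equiv.sum_comp (vertexEquiv X e.toEquiv)] at this
    exact this
  · obtain ⟨x, hx, hxu⟩ := hX.exists_eigenvector (Pi.single u 1)
    rw [mem_eigenspace_adjEnd_iff] at hx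
    refine ⟨x ∘ vertexEquiv X e.toEquiv, fun v => ?_, ?_, fun v hv => ?_⟩
    · have := hx (vertexEquiv X e.toEquiv v)
      rw [← Equiv.sum_comp (vertexEquiv X e.toEquiv)] at this
      exact this
    · simpa [vertexEquiv] using hxu u
    · simpa [vertexEquiv, hv] using hxu v

lemma adjVal_comm {V : Type*} (G : SimpleGraph V) (v w : V) : adjVal G v w = adjVal G w v := by
  classical exact if_congr (G.adj_comm v w) rfl rfl

/-! ### Eigenvector equations over `K_{s,s}` -/

namespace Config

variable {s r : ℕ} {μ : ℝ} {U : Type*} {G : SimpleGraph ((Fin s ⊕ Fin s) ⊕ U)}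

/-- The number of neighbours of `u` in the first part of `K_{s,s}`. -/
noncomputable def leftDeg (G : SimpleGraph ((Fin s ⊕ Fin s) ⊕ U)) (u : U) : ℝ :=
  ∑ i, adjVal G (.inr u) (.inl (.inl i))

/-- The number of neighbours of `u` in the second part of `K_{s,s}`. -/
noncomputable def rightDeg (G : SimpleGraph ((Fin s ⊕ Fin s) ⊕ U)) (u : U) : ℝ :=
  ∑ j, adjVal G (.inr u) (.inl (.inr j))

lemma adjVal_mul_self {V : Type*} (G : SimpleGraph V) (v w : V) :
    adjVal G v w * adjVal G v w = adjVal G v w := by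
  simp [adjVal]

lemma exists_card_left (G : SimpleGraph ((Fin s ⊕ Fin s) ⊕ U)) (u : U) :
    ∃ a : ℕ, leftDeg G u = a := by
  classical
  exact ⟨_, by unfold leftDeg adjVal; exact Finset.sum_boole _ _⟩

lemma exists_card_right (G : SimpleGraph ((Fin s ⊕ Fin s) ⊕ U)) (u : U) :
    ∃ a : ℕ, rightDeg G u = a := by
  classical
  exact ⟨_, by unfold rightDeg adjVal; exact Finset.sum_boole _ _⟩

variable [Fintype U]

lemma adjVal_ll (h : Config s r μ G) (i j : Fin s) :
    adjVal G (.inl (.inl i)) (.inl (.inl j)) = 0 := by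
  simp [adjVal, h.adj_iff]

lemma adjVal_rr (h : Config s r μ G) (i j : Fin s) :
    adjVal G (.inl (.inr i)) (.inl (.inr j)) = 0 := by
  simp [adjVal, h.adj_iff]

lemma adjVal_lr (h : Config s r μ G) (i j : Fin s) :
    adjVal G (.inl (.inl i)) (.inl (.inr j)) = 1 := by
  simp [adjVal, h.adj_iff]

lemma adjVal_rl (h : Config s r μ G) (i j : Fin s) :
    adjVal G (.inl (.inr i)) (.inl (.inl j)) = 1 := by
  simp [adjVal, h.adj_iff]

lemma sum_left (h : Config s r μ G) (i : Fin s) :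
    ∑ u, adjVal G (.inr u) (.inl (.inl i)) = r - s := by
  have := h.degree (.inl (.inl i))
  simp only [Fintype.sum_sum_type, h.adjVal_ll, h.adjVal_lr] at this
  simp only [adjVal_comm G (.inr _)]
  simp at this
  linarith

lemma sum_right (h : Config s r μ G) (i : Fin s) :
    ∑ u, adjVal G (.inr u) (.inl (.inr i)) = r - s := by
  have := h.degree (.inl (.inr i))
  simp only [Fintype.sum_sum_type, h.adjVal_rr, h.adjVal_rl] at this
  simp only [adjVal_comm G (.inr _)]
  simp at this
  linarith

lemma sum_leftDeg (h : Config s r μ G) : ∑ u, leftDeg G u = s * (r - s) := by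
  unfold leftDeg
  rw [Finset.sum_comm]
  simp [h.sum_left, mul_sub]

lemma sum_rightDeg (h : Config s r μ G) : ∑ u, rightDeg G u = s * (r - s) := by
  unfold rightDeg
  rw [Finset.sum_comm]
  simp [h.sum_right, mul_sub]

/-- An eigenvector for an eigenvalue other than the degree is orthogonal to the all-one vector. -/
lemma sum_eq_zero (h : Config s r μ G) (hr : μ ≠ r) {x : (Fin s ⊕ Fin s) ⊕ U → ℝ}
    (hx : ∀ v, ∑ w, adjVal G v w * x w = μ * x v) : ∑ v, x v = 0 := by
  have h1 : ∑ v, ∑ w, adjVal G v w * x w = r * ∑ w, x w := by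
    rw [Finset.sum_comm, Finset.mul_sum]
    refine Finset.sum_congr rfl fun w _ => ?_
    rw [← Finset.sum_mul, ← h.degree w]
    simp only [adjVal_comm G w]
  rw [Finset.sum_congr rfl fun v _ => hx v, ← Finset.mul_sum] at h1
  by_contra h0
  exact hr (mul_right_cancel₀ h0 h1)

open Classical in
/-- The reconstruction relations: the scalars `P u`, `Q u` are the sums over the two parts of
`K_{s,s}` of the eigenvector that belongs to `u`. -/
lemma exists_partSums (h : Config s r μ G) : ∃ P Q : U → ℝ,
    (∀ u, μ * P u - s * Q u = leftDeg G u) ∧ (∀ u, μ * Q u - s * P u = rightDeg G u) ∧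
    (∀ u v, ∑ i, adjVal G (.inr v) (.inl (.inl i)) * adjVal G (.inr u) (.inl (.inl i)) +
        ∑ j, adjVal G (.inr v) (.inl (.inr j)) * adjVal G (.inr u) (.inl (.inr j)) +
        leftDeg G v * Q u + rightDeg G v * P u =
      μ * (μ * (if v = u then 1 else 0) - adjVal G (.inr v) (.inr u))) ∧
    (μ ≠ r → ∀ u, P u + Q u = -1) := by
  choose x hx hx1 hx0 using h.exists_vec
  have hU : ∀ u v, x u (.inr v) = if v = u then 1 else 0 := by
    intro u v
    split_ifs with huv
    · rw [huv, hx1]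
    · exact hx0 u v huv
  have hl : ∀ u i, μ * x u (.inl (.inl i)) =
      ∑ j, x u (.inl (.inr j)) + adjVal G (.inr u) (.inl (.inl i)) := by
    intro u i
    rw [← hx u]
    simp [Fintype.sum_sum_type, h.adjVal_ll, h.adjVal_lr, hU, adjVal_comm G (.inr u)]
  have hr : ∀ u i, μ * x u (.inl (.inr i)) =
      ∑ j, x u (.inl (.inl j)) + adjVal G (.inr u) (.inl (.inr i)) := by
    intro u i
    rw [← hx u]
    simp [Fintype.sum_sum_type, h.adjVal_rr, h.adjVal_rl, hU, adjVal_comm G (.inr u)]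
  refine ⟨fun u => ∑ i, x u (.inl (.inl i)), fun u => ∑ i, x u (.inl (.inr i)),
    fun u => ?_, fun u => ?_, fun u v => ?_, fun hne u => ?_⟩
  · rw [Finset.mul_sum]
    simp [hl, Finset.sum_add_distrib, leftDeg]
  · rw [Finset.mul_sum]
    simp [hr, Finset.sum_add_distrib, rightDeg]
  · have hv := hx u (.inr v)
    rw [hU] at hv
    simp only [Fintype.sum_sum_type, hU, mul_ite, mul_one, mul_zero, Finset.sum_ite_eq',
      Finset.mem_univ, if_true] at hv
    -- Multiplying the equation at `v` by `μ` lets `hl` and `hr` eliminate the entries of `x u` on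
    -- `K_{s,s}`, leaving only its part sums.
    have h1 : μ * ∑ i, adjVal G (.inr v) (.inl (.inl i)) * x u (.inl (.inl i)) =
        ∑ i, adjVal G (.inr v) (.inl (.inl i)) * adjVal G (.inr u) (.inl (.inl i)) +
        leftDeg G v * ∑ j, x u (.inl (.inr j)) := by
      rw [leftDeg, Finset.sum_mul, ← Finset.sum_add_distrib, Finset.mul_sum]
      refine Finset.sum_congr rfl fun i _ => ?_
      linear_combination adjVal G (.inr v) (.inl (.inl i)) * hl u i
    have h2 : μ * ∑ i, adjVal G (.inr v) (.inl (.inr i)) * x u (.inl (.inr i)) =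
        ∑ i, adjVal G (.inr v) (.inl (.inr i)) * adjVal G (.inr u) (.inl (.inr i)) +
        rightDeg G v * ∑ j, x u (.inl (.inl j)) := by
      rw [rightDeg, Finset.sum_mul, ← Finset.sum_add_distrib, Finset.mul_sum]
      refine Finset.sum_congr rfl fun i _ => ?_
      linear_combination adjVal G (.inr v) (.inl (.inr i)) * hr u i
    have hv' : μ * (∑ i, adjVal G (.inr v) (.inl (.inl i)) * x u (.inl (.inl i)) +
        ∑ i, adjVal G (.inr v) (.inl (.inr i)) * x u (.inl (.inr i)) +
        adjVal G (.inr v) (.inr u)) = μ * (μ * (if v = u then 1 else 0)) := by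
      rw [hv]; simp
    linear_combination hv' - h1 - h2
  · have := h.sum_eq_zero hne (hx u)
    simp only [Fintype.sum_sum_type, hU, Finset.sum_ite_eq', Finset.mem_univ, if_true] at this
    linarith

/-! ### Possible numbers of neighbours in `K_{s,s}` -/

/-- In the non-principal case every vertex of the star set has `s - μ` neighbours in `K_{s,s}`. -/
lemma leftDeg_add_rightDeg (h : Config s r μ G) (hr : μ ≠ r) (u : U) :
    leftDeg G u + rightDeg G u = s - μ := by
  obtain ⟨P, Q, h1, h2, -, h4⟩ := h.exists_partSums
  linear_combination -h1 u - h2 u + (μ - s) * h4 hr u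

/-- The numerical constraints on a vertex of the star set. -/
lemma exists_numeric (h : Config s r μ G) (hr : μ ≠ r) (u : U) : ∃ (a b : ℕ) (P Q : ℝ),
    leftDeg G u = a ∧ rightDeg G u = b ∧ μ * P - s * Q = a ∧ μ * Q - s * P = b ∧ P + Q = -1 ∧
    a + b + a * Q + b * P = μ * μ ∧ (a + b : ℝ) = s - μ := by
  obtain ⟨a, ha⟩ := exists_card_left G u
  obtain ⟨b, hb⟩ := exists_card_right G u
  have hd := h.leftDeg_add_rightDeg hr u
  obtain ⟨P, Q, h1, h2, h3, h4⟩ := h.exists_partSums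
  refine ⟨a, b, P u, Q u, ha, hb, ha ▸ h1 u, hb ▸ h2 u, h4 hr u, ?_, by rw [← ha, ← hb, hd]⟩
  have := h3 u u
  simp only [adjVal_mul_self] at this
  change leftDeg G u + rightDeg G u + _ + _ = _ at this
  rw [ha, hb] at this
  simpa [adjVal] using this

/-- Every vertex of the star set has at least two neighbours in `K_{s,s}`. -/
lemma two_le_add (h : Config s r μ G) (hs : 1 ≤ s) (hr : μ ≠ r) (h0 : μ ≠ 0) (u : U) :
    2 ≤ s - μ := by
  obtain ⟨a, b, P, Q, -, -, h1, h2, h3, h4, h5⟩ := h.exists_numeric hr u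
  rw [← h5]
  by_contra hlt
  have hab : a + b < 2 := by exact_mod_cast not_le.1 hlt
  have key : ∀ R T : ℝ, μ * R - s * T = 1 → μ * T - s * R = 0 → R + T = -1 → 1 + T = μ * μ →
      (s : ℝ) - μ = 1 → False := by
    intro R T e1 e2 e3 e4 e5
    obtain rfl : μ = s - 1 := by linarith
    obtain rfl : R = -1 - T := by linarith
    -- `e2` now reads `(2s - 1)T = -s`; this eliminates `T` from `e4`.
    have e6 : ((s : ℝ) - 1) * ((s - 1) * (2 * s - 1) - 1) = 0 := by
      linear_combination (-(2 * s - 1 : ℝ)) * e4 + e2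
    rcases mul_eq_zero.1 e6 with e7 | e7
    · exact h0 e7
    · have e8 : ((s : ℤ) - 1) * (2 * s - 1) = 1 := by
        have : ((s : ℝ) - 1) * (2 * s - 1) = 1 := by linarith
        exact_mod_cast this
      have := Int.eq_one_or_neg_one_of_mul_eq_one e8
      rcases this with e9 | e9
      · have : (s : ℤ) = 2 := by linarith
        rw [this] at e8; norm_num at e8
      · omega
  have : (a = 0 ∧ b = 0) ∨ (a = 1 ∧ b = 0) ∨ (a = 0 ∧ b = 1) := by omega
  rcases this with ⟨rfl, rfl⟩ | ⟨rfl, rfl⟩ | ⟨rfl, rfl⟩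
  · apply h0; simpa using h4
  · norm_num at *
    exact key P Q h1 h2 h3 h4 (by linarith)
  · norm_num at *
    exact key Q P h2 h1 (by linarith) h4 (by linarith)

/-- Two neighbours in `K_{s,s}` for each vertex of the star set force `s = 3`, `μ = 1` and one
neighbour in each part. -/
lemma eq_three_of_add_eq_two (h : Config s r μ G) (hs : 2 ≤ s) (hr : μ ≠ r) (h0 : μ ≠ 0)
    (hd : (s : ℝ) - μ = 2) (u : U) :
    s = 3 ∧ leftDeg G u = 1 ∧ rightDeg G u = 1 := by
  obtain ⟨a, b, P, Q, ha, hb, h1, h2, h3, h4, h5⟩ := h.exists_numeric hr u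
  rw [hd] at h5
  have hab : a + b = 2 := by exact_mod_cast h5
  have hs' : (2 : ℝ) ≤ s := by exact_mod_cast hs
  obtain rfl : μ = s - 2 := by linarith
  have key : ∀ R T : ℝ, (s - 2 : ℝ) * R - s * T = 2 → (s - 2 : ℝ) * T - s * R = 0 → R + T = -1 →
      2 + 2 * T = (s - 2 : ℝ) * (s - 2) → False := by
    intro R T e1 e2 e3 e4
    obtain rfl : R = -1 - T := by linarith
    -- Here `e2` reads `2(s - 1)T = -s`.
    have e6 : ((s : ℝ) - 2) * ((s - 1) * (s - 2) - 1) = 0 := by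
      linear_combination (-(s - 1 : ℝ)) * e4 + e2
    rcases mul_eq_zero.1 e6 with e7 | e7
    · exact h0 e7
    · have e8 : ((s : ℤ) - 1) * (s - 2) = 1 := by
        have : ((s : ℝ) - 1) * (s - 2) = 1 := by linarith
        exact_mod_cast this
      rcases Int.eq_one_or_neg_one_of_mul_eq_one e8 with e9 | e9
      · have : (s : ℤ) = 2 := by linarith
        rw [this] at e8; norm_num at e8
      · omega
  have : (a = 2 ∧ b = 0) ∨ (a = 1 ∧ b = 1) ∨ (a = 0 ∧ b = 2) := by omega
  rcases this with ⟨rfl, rfl⟩ | ⟨rfl, rfl⟩ | ⟨rfl, rfl⟩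
  · norm_num at *
    exact absurd (key P Q h1 h2 h3 h4) id
  · norm_num at *
    refine ⟨?_, ha, hb⟩
    have h6 : ((s : ℝ) - 1) * (s - 3) = 0 := by linear_combination h3 - h4
    rcases mul_eq_zero.1 h6 with h7 | h7
    · exact absurd (by exact_mod_cast sub_eq_zero.1 h7 : s = 1) (by omega)
    · exact_mod_cast sub_eq_zero.1 h7
  · norm_num at *
    exact absurd (key Q P h2 h1 (by linarith) h4) id

end Config
-- Grid patterns and the three graphs
/-- A regular pattern in the `3 × 3` grid is, up to a permutation of the columns, the diagonal,
its complement or the whole grid. -/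
lemma exists_perm_of_regular : ∀ F : Fin 3 → Fin 3 → Bool,
    (∀ i j, (Finset.univ.filter fun k => F i k = true).card =
      (Finset.univ.filter fun k => F k j = true).card) → (∃ i j, F i j = true) →
    ∃ σ : Equiv.Perm (Fin 3), (∀ i j, F i j = true ↔ i = σ j) ∨ (∀ i j, F i j = true ↔ i ≠ σ j) ∨
      ∀ i j, F i j = true := by
  decide +kernel

instance gridGraph.decidableAdj (S : Set (Fin 3 × Fin 3)) : DecidableRel (gridGraph S).Adj
  | .inl (.inl _), .inl (.inl _) => isFalse id
  | .inl (.inl _), .inl (.inr _) => isTrue trivial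
  | .inl (.inr _), .inl (.inl _) => isTrue trivial
  | .inl (.inr _), .inl (.inr _) => isFalse id
  | .inl (.inl i), .inr c => inferInstanceAs (Decidable (c.1.1 = i))
  | .inl (.inr j), .inr c => inferInstanceAs (Decidable (c.1.2 = j))
  | .inr c, .inl (.inl i) => inferInstanceAs (Decidable (c.1.1 = i))
  | .inr c, .inl (.inr j) => inferInstanceAs (Decidable (c.1.2 = j))
  | .inr c, .inr d => inferInstanceAs (Decidable (c.1.1 ≠ d.1.1 ∧ c.1.2 ≠ d.1.2))

instance : DecidableRel G₁.Adj := gridGraph.decidableAdj _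
instance : DecidableRel G₂.Adj := gridGraph.decidableAdj _
instance : DecidableRel G₃.Adj := gridGraph.decidableAdj _

/-- One vertex suffices: these degrees are only compared with those of an isomorphic graph already
known to be regular. -/
lemma degree_G₁ : G₁.degree (.inl (.inl 0)) = 4 := by decide +kernel
lemma degree_G₂ : G₂.degree (.inl (.inl 0)) = 5 := by decide +kernel
lemma degree_G₃ : G₃.degree (.inl (.inl 0)) = 6 := by decide +kernel
lemma card_G₁ : Fintype.card ((Fin 3 ⊕ Fin 3) ⊕ {c : Fin 3 × Fin 3 | c.1 = c.2}) = 9 := by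
  decide +kernel
lemma card_G₂ : Fintype.card ((Fin 3 ⊕ Fin 3) ⊕ {c : Fin 3 × Fin 3 | c.1 ≠ c.2}) = 12 := by
  decide +kernel
lemma card_G₃ : Fintype.card ((Fin 3 ⊕ Fin 3) ⊕ (Set.univ : Set (Fin 3 × Fin 3))) = 15 := by
  decide +kernel

namespace Config

variable {s r : ℕ} {μ : ℝ} {U : Type*} [Fintype U] {G : SimpleGraph ((Fin s ⊕ Fin s) ⊕ U)}

/-! ### The principal eigenvalue `μ = r` -/

/-- A vertex of `K_{s,s}` with a neighbour in the star set has degree exceeding `s`. -/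
lemma lt_of_adj (h : Config s r μ G) {u : U} {y : Fin s ⊕ Fin s} (hy : G.Adj (.inr u) (.inl y)) :
    s < r := by
  have key : ∑ v, adjVal G (.inr v) (.inl y) = r - s := by
    rcases y with y | y
    · exact h.sum_left y
    · exact h.sum_right y
  have h1 : adjVal G (.inr u) (.inl y) ≤ ∑ v, adjVal G (.inr v) (.inl y) :=
    Finset.single_le_sum (f := fun v => adjVal G (.inr v) (.inl y))
      (fun v _ => by unfold adjVal; split_ifs <;> simp) (Finset.mem_univ u)
  have h2 : adjVal G (.inr u) (.inl y) = 1 := by simp [adjVal, hy]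
  have : (s : ℝ) < r := by linarith
  exact_mod_cast this

/-- Eigenvectors for the degree are constant along edges. -/
lemma eq_of_adj (h : Config s r r G) {x : (Fin s ⊕ Fin s) ⊕ U → ℝ}
    (hx : ∀ v, ∑ w, adjVal G v w * x w = r * x v) {v w} (hvw : G.Adj v w) : x v = x w := by
  -- The sum is twice the quadratic form of `rI - A` at `x`.
  have h1 : ∑ v, ∑ w, adjVal G v w * (x v - x w) ^ 2 = 0 := by
    have e1 : ∑ v, ∑ w, adjVal G v w * x v ^ 2 = ∑ v, r * x v ^ 2 :=
      Finset.sum_congr rfl fun v _ => by rw [← Finset.sum_mul, h.degree]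
    have e2 : ∑ v, ∑ w, adjVal G v w * x w ^ 2 = ∑ v, r * x v ^ 2 := by
      rw [Finset.sum_comm]
      exact Finset.sum_congr rfl fun v _ => by
        rw [← Finset.sum_mul, ← h.degree v]; simp only [adjVal_comm G v]
    have e3 : ∑ v, ∑ w, x v * (adjVal G v w * x w) = ∑ v, r * x v ^ 2 :=
      Finset.sum_congr rfl fun v _ => by rw [← Finset.mul_sum, hx]; ring
    have : ∀ v w, adjVal G v w * (x v - x w) ^ 2 =
        adjVal G v w * x v ^ 2 + adjVal G v w * x w ^ 2 - 2 * (x v * (adjVal G v w * x w)) := by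
      intro v w; ring
    simp only [this, Finset.sum_sub_distrib, Finset.sum_add_distrib, e1, e2]
    simp_rw [← Finset.mul_sum Finset.univ _ (2 : ℝ)]
    rw [e3]
    ring
  have hnn : ∀ v w, 0 ≤ adjVal G v w * (x v - x w) ^ 2 := fun v w =>
    mul_nonneg (by unfold adjVal; split_ifs <;> simp) (sq_nonneg _)
  have h2 := (Finset.sum_eq_zero_iff_of_nonneg fun v _ => Finset.sum_nonneg fun w _ => hnn v w).1
    h1 v (Finset.mem_univ _)
  have h3 := (Finset.sum_eq_zero_iff_of_nonneg fun w _ => hnn v w).1 h2 w (Finset.mem_univ _)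
  simpa [adjVal, hvw, sub_eq_zero] using h3

/-- If the eigenvalue is the degree, every vertex of the star set has a neighbour in `K_{s,s}`. -/
lemma exists_adj (h : Config s r r G) (hr : r ≠ 0) (u : U) : ∃ y, G.Adj (.inr u) (.inl y) := by
  by_contra! hno
  obtain ⟨x, hx, hxu, hx0⟩ := h.exists_vec u
  apply hr
  have := h.degree (.inr u)
  rw [Finset.sum_eq_zero] at this
  · exact_mod_cast this.symm
  rintro (y | v) -
  · simp [adjVal, hno y]
  · have hv : ¬ G.Adj (.inr u) (.inr v) := by
      intro hv
      have h1 := h.eq_of_adj hx hv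
      rw [hxu, hx0 v (by rintro rfl; exact G.loopless.irrefl _ hv)] at h1
      exact one_ne_zero h1
    simp [adjVal, hv]

/-- If the eigenvalue is the degree, the star set has only one vertex. -/
lemma eq_of_principal (h : Config s r r G) (hr : r ≠ 0) (u v : U) : v = u := by
  by_contra hvu
  obtain ⟨x, hx, hxu, hx0⟩ := h.exists_vec u
  obtain ⟨y, hy⟩ := h.exists_adj hr u
  obtain ⟨z, hz⟩ := h.exists_adj hr v
  have hy1 := h.eq_of_adj hx hy
  have hz1 := h.eq_of_adj hx hz
  rw [hxu] at hy1
  rw [hx0 v hvu] at hz1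
  -- Connectedness of `K_{s,s}` makes `x` constant on it, whereas its values at `y` and `z` are 1
  -- and 0.
  have hc : ∀ i j, x (.inl (.inl i)) = x (.inl (.inr j)) := fun i j =>
    h.eq_of_adj hx ((h.adj_iff _ _).2 (by simp))
  rcases y with i | i <;> rcases z with j | j
  · linarith [hc i i, hc j i]
  · linarith [hc i j]
  · linarith [hc j i]
  · linarith [hc i i, hc i j]

/-! ### The bound and the case of equality -/

lemma card_mul (h : Config s r μ G) (hr : μ ≠ r) :
    (Fintype.card U : ℝ) * (s - μ) = 2 * (s * (r - s)) := by
  have : ∑ u, (leftDeg G u + rightDeg G u) = 2 * (s * (r - s)) := by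
    rw [Finset.sum_add_distrib, h.sum_leftDeg, h.sum_rightDeg]; ring
  simpa only [h.leftDeg_add_rightDeg hr, Finset.sum_const, Finset.card_univ, nsmul_eq_mul]
    using this

lemma card_le (h : Config s r μ G) (hs : 1 ≤ s) (h0 : μ ≠ 0) [Nonempty U] :
    (Fintype.card U : ℤ) ≤ s * (r - s) := by
  obtain ⟨u⟩ := ‹Nonempty U›
  by_cases hr : μ = r
  · subst hr
    have hr0 : r ≠ 0 := by exact_mod_cast h0
    have h1 : Fintype.card U = 1 := Fintype.card_eq_one_iff.2 ⟨u, h.eq_of_principal hr0 u⟩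
    obtain ⟨y, hy⟩ := h.exists_adj hr0 u
    have h2 := h.lt_of_adj hy
    rw [h1]
    push_cast
    have h3 : (1 : ℤ) ≤ s := by exact_mod_cast hs
    have h4 : (1 : ℤ) ≤ r - s := by omega
    nlinarith
  · have h1 := h.card_mul hr
    have h2 := h.two_le_add hs hr h0 u
    have h3 : (0 : ℝ) ≤ Fintype.card U := Nat.cast_nonneg _
    have : (Fintype.card U : ℝ) ≤ s * (r - s) := by nlinarith
    exact_mod_cast this

lemma ne_of_card_eq (h : Config s r μ G) (hs : 2 ≤ s) (h0 : μ ≠ 0) [Nonempty U]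
    (hc : (Fintype.card U : ℤ) = s * (r - s)) : μ ≠ r := by
  obtain ⟨u⟩ := ‹Nonempty U›
  rintro rfl
  have hr0 : r ≠ 0 := by exact_mod_cast h0
  have h1 : Fintype.card U = 1 := Fintype.card_eq_one_iff.2 ⟨u, h.eq_of_principal hr0 u⟩
  rw [h1] at hc
  rcases Int.eq_one_or_neg_one_of_mul_eq_one hc.symm with h2 | h2 <;> omega

lemma exists_iff_eq {ι : Type*} [Fintype ι] {V : Type*} {G : SimpleGraph V} {v : V} {f : ι → V}
    (h : ∑ i, adjVal G v (f i) = 1) : ∃ i, ∀ j, G.Adj v (f j) ↔ j = i := by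
  classical
  have hv (i : ι) : adjVal G v (f i) = if G.Adj v (f i) then 1 else 0 := by simp [adjVal]
  simp only [hv, Finset.sum_boole] at h
  obtain ⟨i, hi⟩ := Finset.card_eq_one.1 (by exact_mod_cast h)
  exact ⟨i, fun j => by simpa using Finset.ext_iff.1 hi j⟩

/-- The graph is determined by the cells of the `3 × 3` grid attached to the star set. -/
lemma exists_cells {G : SimpleGraph ((Fin 3 ⊕ Fin 3) ⊕ U)} (h : Config 3 r 1 G)
    (ha : ∀ u, leftDeg G u = 1) (hb : ∀ u, rightDeg G u = 1) : ∃ f g : U → Fin 3,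
    (∀ u i, G.Adj (.inr u) (.inl (.inl i)) ↔ i = f u) ∧
    (∀ u j, G.Adj (.inr u) (.inl (.inr j)) ↔ j = g u) ∧
    (∀ u v, f u = f v → g u = g v → u = v) ∧
    (∀ u v, G.Adj (.inr u) (.inr v) ↔ f u ≠ f v ∧ g u ≠ g v) := by
  classical
  choose f hf using fun u => exists_iff_eq (ha u)
  choose g hg using fun u => exists_iff_eq (hb u)
  obtain ⟨P, Q, h1, h2, h3, -⟩ := h.exists_partSums
  -- Since `P + Q = -1`, the number of shared coordinates decides everything: two force `u = v`, one
  -- forbids adjacency, none forces it.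
  have key : ∀ u v, (if f u = f v then (1 : ℝ) else 0) + (if g u = g v then 1 else 0) - 1 =
      (if u = v then 1 else 0) - adjVal G (.inr u) (.inr v) := by
    intro u v
    have e1 := h1 v
    have e2 := h2 v
    have e3 := h3 v u
    simp only [adjVal, hf, hg, ite_mul, one_mul, zero_mul, Finset.sum_ite_eq',
      Finset.mem_univ, if_true, ha, hb] at e1 e2 e3 ⊢
    push_cast at e1 e2
    linear_combination e3 + (1 / 2) * e1 + (1 / 2) * e2
  refine ⟨f, g, hf, hg, fun u v e1 e2 => ?_, fun u v => ?_⟩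
  · by_contra hne
    have := key u v
    rw [if_pos e1, if_pos e2, if_neg hne, adjVal] at this
    split_ifs at this <;> norm_num at this
  · have := key u v
    by_cases hne : u = v
    · subst hne; simp
    · rw [if_neg hne, adjVal] at this
      split_ifs at this with h4 h5 h6 <;> norm_num at this <;> tauto

/-- Adjacency depends only on equality of coordinates, so the second part may be relabelled by any
`σ`. -/
lemma nonempty_iso_gridGraph {G : SimpleGraph ((Fin 3 ⊕ Fin 3) ⊕ U)} (h : Config 3 r μ G)
    {f g : U → Fin 3} (hf : ∀ u i, G.Adj (.inr u) (.inl (.inl i)) ↔ i = f u)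
    (hg : ∀ u j, G.Adj (.inr u) (.inl (.inr j)) ↔ j = g u)
    (hinj : ∀ u v, f u = f v → g u = g v → u = v)
    (hadj : ∀ u v, G.Adj (.inr u) (.inr v) ↔ f u ≠ f v ∧ g u ≠ g v)
    (σ : Equiv.Perm (Fin 3)) (S : Set (Fin 3 × Fin 3))
    (hS : ∀ i j, (i, σ j) ∈ S ↔ ∃ u, f u = i ∧ g u = j) : Nonempty (G ≃g gridGraph S) := by
  let φ : U → S := fun u => ⟨(f u, σ (g u)), (hS _ _).2 ⟨u, rfl, rfl⟩⟩
  have hφ : Function.Bijective φ := by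
    constructor
    · intro u v huv
      have := congrArg Subtype.val huv
      simp only [φ, Prod.mk.injEq, σ.injective.eq_iff] at this
      exact hinj u v this.1 this.2
    · rintro ⟨⟨i, j⟩, hij⟩
      obtain ⟨u, rfl, hu⟩ := (hS i (σ.symm j)).1 (by simpa using hij)
      exact ⟨u, Subtype.ext (by simp [φ, hu])⟩
  refine ⟨⟨Equiv.sumCongr (Equiv.sumCongr (Equiv.refl _) σ) (Equiv.ofBijective φ hφ), ?_⟩⟩
  rintro ((i | i) | u) ((j | j) | v)
  · simp [gridGraph, h.adj_iff]
  · simp [gridGraph, h.adj_iff]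
  · rw [G.adj_comm, hf]; exact eq_comm
  · simp [gridGraph, h.adj_iff]
  · simp [gridGraph, h.adj_iff]
  · rw [G.adj_comm, hg]; exact σ.injective.eq_iff.trans eq_comm
  · rw [hf]; exact eq_comm
  · rw [hg]; exact σ.injective.eq_iff.trans eq_comm
  · rw [hadj]; exact and_congr Iff.rfl (σ.injective.ne_iff)

lemma nonempty_iso {G : SimpleGraph ((Fin 3 ⊕ Fin 3) ⊕ U)} (h : Config 3 r 1 G) [Nonempty U]
    (ha : ∀ u, leftDeg G u = 1) (hb : ∀ u, rightDeg G u = 1) :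
    Nonempty (G ≃g G₁) ∨ Nonempty (G ≃g G₂) ∨ Nonempty (G ≃g G₃) := by
  classical
  obtain ⟨f, g, hf, hg, hinj, hadj⟩ := h.exists_cells ha hb
  let F : Fin 3 → Fin 3 → Bool := fun i j => decide (∃ u, f u = i ∧ g u = j)
  have hF : ∀ i j, F i j = true ↔ ∃ u, f u = i ∧ g u = j := fun i j => decide_eq_true_iff
  -- A vertex of `K_{3,3}` has `r - 3` neighbours in the star set, and distinct ones occupy distinct
  -- cells.
  have hrow : ∀ i, ((Finset.univ.filter fun k => F i k = true).card : ℝ) = r - 3 := by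
    intro i
    have e : (Finset.univ.filter fun k => F i k = true) =
        (Finset.univ.filter fun u => i = f u).image g := by
      ext k; simp [hF, eq_comm]
    rw [e, Finset.card_image_of_injOn]
    · have := h.sum_left i
      simp only [adjVal, hf, Finset.sum_boole] at this
      exact_mod_cast this
    · intro u hu v hv huv
      simp only [Finset.coe_filter, Finset.mem_univ, true_and, Set.mem_ofPred_eq] at hu hv
      exact hinj u v (hu.symm.trans hv) huv
  have hcol : ∀ j, ((Finset.univ.filter fun k => F k j = true).card : ℝ) = r - 3 := by
    intro j
    have e : (Finset.univ.filter fun k => F k j = true) =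
        (Finset.univ.filter fun u => j = g u).image f := by
      ext k; simp [hF, eq_comm, and_comm]
    rw [e, Finset.card_image_of_injOn]
    · have := h.sum_right j
      simp only [adjVal, hg, Finset.sum_boole] at this
      exact_mod_cast this
    · intro u hu v hv huv
      simp only [Finset.coe_filter, Finset.mem_univ, true_and, Set.mem_ofPred_eq] at hu hv
      exact hinj u v huv (hu.symm.trans hv)
  obtain ⟨u⟩ := ‹Nonempty U›
  obtain ⟨σ, h1 | h1 | h1⟩ := exists_perm_of_regular F
    (fun i j => by exact_mod_cast (hrow i).trans (hcol j).symm)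
    ⟨f u, g u, (hF _ _).2 ⟨u, rfl, rfl⟩⟩
  · exact .inl (h.nonempty_iso_gridGraph hf hg hinj hadj σ _
      fun i j => (h1 i j).symm.trans (hF i j))
  · exact .inr (.inl (h.nonempty_iso_gridGraph hf hg hinj hadj σ _
      fun i j => (h1 i j).symm.trans (hF i j)))
  · exact .inr (.inr (h.nonempty_iso_gridGraph hf hg hinj hadj σ _
      fun i j => iff_of_true (Set.mem_univ _) ((hF i j).1 (h1 i j))))

/-- The graphs attaining equality. -/
lemma of_card_eq (h : Config s r μ G) (hs : 2 ≤ s) (h0 : μ ≠ 0) [Nonempty U]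
    (hc : (Fintype.card U : ℤ) = s * (r - s)) :
    μ = 1 ∧ (Nonempty (G ≃g G₁) ∨ Nonempty (G ≃g G₂) ∨ Nonempty (G ≃g G₃)) := by
  have hr := h.ne_of_card_eq hs h0 hc
  have hc' : (Fintype.card U : ℝ) = s * (r - s) := by exact_mod_cast hc
  have hpos : (Fintype.card U : ℝ) ≠ 0 := by simp
  have hd : (s : ℝ) - μ = 2 := by
    have := h.card_mul hr
    rw [← hc', mul_comm 2] at this
    exact mul_left_cancel₀ hpos this
  have hall := h.eq_three_of_add_eq_two hs hr h0 hd
  obtain rfl : s = 3 := (hall (Classical.arbitrary U)).1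
  obtain rfl : μ = 1 := by norm_num at hd; linarith
  exact ⟨rfl, h.nonempty_iso (fun u => (hall u).2.1) fun u => (hall u).2.2⟩

lemma card_eq_of_eq_one (h : Config s r 1 G) (hs : 2 ≤ s)
    (hcard : (r = 4 ∧ 2 * s + Fintype.card U = 9) ∨ (r = 5 ∧ 2 * s + Fintype.card U = 12) ∨
      (r = 6 ∧ 2 * s + Fintype.card U = 15)) : (Fintype.card U : ℤ) = s * (r - s) := by
  have hr : (1 : ℝ) ≠ r := by
    have : 1 ≠ r := by omega
    exact_mod_cast this
  have h1 : (Fintype.card U : ℤ) * (s - 1) = 2 * (s * (r - s)) := by exact_mod_cast h.card_mul hr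
  -- In each case the terms in `s²` cancel, leaving `(r - 1)s = 3(r - 1)`.
  have h3 : s = 3 := by
    rcases hcard with ⟨rfl, h2⟩ | ⟨rfl, h2⟩ | ⟨rfl, h2⟩ <;> zify at h2 ⊢ <;> push_cast at h1 <;>
      nlinarith
  subst h3
  omega

end Config
end StarComplement

theorem mainTheorem2 {V : Type*} [Fintype V] (G : SimpleGraph V) [DecidableRel G.Adj]
    (n r s k : ℕ) (μ : ℝ) (hs : 1 ≤ s)
    (hn : Fintype.card V = n)
    (hreg : G.IsRegularOfDegree r)
    (hμ : StarComplement.IsEigenvalue G μ)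
    (hk : StarComplement.multiplicity G μ = k)
    (hμ_ne_neg_one : μ ≠ -1) (hμ_ne_zero : μ ≠ 0)
    (hstar : StarComplement.HasStarComplement G μ (completeBipartiteGraph (Fin s) (Fin s))) :
    (k : ℤ) ≤ s * (r - s) ∧
    (n : ℤ) ≤ s * (r - s + 2) ∧
    ((k : ℤ) ≤ s * (r - s) ↔ (n : ℤ) ≤ s * (r - s + 2)) ∧
    ((k : ℤ) = s * (r - s) ↔ (n : ℤ) = s * (r - s + 2)) ∧
    (2 ≤ s →
      ((k : ℤ) = s * (r - s) ↔
        μ = 1 ∧ (Nonempty (G ≃g StarComplement.G₁) ∨ Nonempty (G ≃g StarComplement.G₂) ∨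
          Nonempty (G ≃g StarComplement.G₃)))) := by
  classical
  obtain ⟨X, hX, ⟨e⟩⟩ := hstar
  have hcfg := hX.config hreg e
  have hcX : Fintype.card X = k := by
    rw [← hk, ← hX.1, ← Nat.card_eq_fintype_card, Nat.card_coe_set_eq]
  have hcV : 2 * s + k = n := by
    rw [← hn, ← Fintype.card_congr (StarComplement.vertexEquiv X e.toEquiv), ← hcX]
    simp [two_mul]
  have hk0 : 0 < k := by
    rw [← hk]
    exact Module.finrank_pos_iff.2 ((Submodule.nontrivial_iff_ne_bot).2 hμ)
  have : Nonempty X := Fintype.card_pos_iff.1 (hcX ▸ hk0)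
  have hle := hcfg.card_le hs hμ_ne_zero
  rw [hcX] at hle
  have hn' : (n : ℤ) = 2 * s + k := by exact_mod_cast hcV.symm
  have hmul : (s : ℤ) * (r - s + 2) = s * (r - s) + 2 * s := by ring
  have ψ : G.comap (StarComplement.vertexEquiv X e.toEquiv) ≃g G := SimpleGraph.Iso.comap _ G
  refine ⟨hle, by linarith, by constructor <;> intro <;> linarith,
    by constructor <;> intro <;> linarith, fun hs2 => ⟨fun heq => ?_, ?_⟩⟩
  · obtain ⟨h1, h2⟩ := hcfg.of_card_eq hs2 hμ_ne_zero (by rw [hcX, heq])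
    exact ⟨h1, h2.imp (fun ⟨f⟩ => ⟨ψ.symm.trans f⟩)
      (Or.imp (fun ⟨f⟩ => ⟨ψ.symm.trans f⟩) fun ⟨f⟩ => ⟨ψ.symm.trans f⟩)⟩
  · rintro ⟨rfl, h⟩
    rw [← hcX]
    refine hcfg.card_eq_of_eq_one hs2 ?_
    rw [hcX, hcV, ← hn]
    refine h.imp (fun ⟨f⟩ => ?_) (Or.imp (fun ⟨f⟩ => ?_) fun ⟨f⟩ => ?_)
    · exact ⟨by rw [← StarComplement.degree_G₁, ← f.symm.degree_eq, hreg],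
        (Fintype.card_congr f.toEquiv).trans StarComplement.card_G₁⟩
    · exact ⟨by rw [← StarComplement.degree_G₂, ← f.symm.degree_eq, hreg],
        (Fintype.card_congr f.toEquiv).trans StarComplement.card_G₂⟩
    · exact ⟨by rw [← StarComplement.degree_G₃, ← f.symm.degree_eq, hreg],
        (Fintype.card_congr f.toEquiv).trans StarComplement.card_G₃⟩
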